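/- Let $\mathcal G$ be a connected simple undirected graph on the vocabulary $[c]=\{1,\dots,c\}$, $c\ge 2$. Let $\boldsymbol\pi=(\pi_x)_{x\in[c]}$ be the stationary distribution of the simple random walk on $\mathcal G$ (which moves from a vertex to a uniformly chosen neighbour). Let $n>10c$, and let the random token sequence $x_1,\dots,x_n\in[c]$ be generated as follows: $x_k=k$ for $k\le c$, the token $x_{c+1}$ has law $\boldsymbol\pi$, and $x_{c+1},x_{c+2},\dots,x_n$ is a simple random walk on $\mathcal G$. Write $F_{y,k}=\#\{j\le k: x_j=y\}$. Definitions (for a given token sequence). * A sequence $\mathcal U=(\boldsymbol u_k)_{k=1}^n$ in $\mathbb R^d$ is a *good sequence* converging to $\mathcal Z=(\boldsymbol z_x)_{x\in[c]}$ (in $\mathbb R^d$) with parameter $\gamma>0$ if $\|\boldsymbol u_k-\boldsymbol z_{x_k}\|\le \gamma/\sqrt k$ for all $k\in[n]$, where $\|\cdot\|$ is the Euclidean norm. One calls $\mathcal Z$ its latent representations. * A matrix $\boldsymbol A=(a_{k,j})\in\mathbb R^{n\times n}$ with nonnegative entries is an *attention map* if $a_{k,j}=0$ for $j>k$ and $\sum_{j\le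 k}a_{k,j}=1$ for all $k$. It is *nice* with parameter $\psi>0$ if moreover $\sum_{i\le j}a_{k,i}\le \psi j/k$ for all $1\le j\le k\le n$. * A nice attention map $\boldsymbol A$ with parameter $\psi$ *reflects* $f:[c]\to 2^{[c]}$ if, for all $k>c$ and $j\le k$, $a_{k,j}>0$ implies $x_j\in f(x_k)$, and if for all $k\in[n]$ and $y\in f(x_k)$ $$\Bigl|\sum_{j\le k,\,x_j=y}a_{k,j}-\frac{F_{y,k}}{\sum_{y'\in f(x_k)}F_{y',k}}\Bigr|\le\frac{\psi}{\sqrt k}$$ (with $0/0=0$, which can occur only for $k\le c$). * $\boldsymbol A\mathcal V=\bigl(\sum_{j=1}^n a_{k,j}\boldsymbol v_j\bigr)_{k=1}^n$ for $\mathcal V=(\boldsymbol v_k)_{k=1}^n$. **Theorem.** There is a constant $C>0$ that depends only on $\mathcal G$ such that, for every $n>10c$, there is an event of probability at least $0.999$ on which the following holds for all $d$, $\mathcal V$, $\mathcal Z$, $\gamma$, $\boldsymbol A$, $\psi$ and $f$. If $\mathcal V=(\boldsymbol v_k)_{k=1}^n\in(\mathbb R^d)^n$ is a good sequence converging to $\mathcal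 Z=(\boldsymbol z_x)_{x\in[c]}$ with parameter $\gamma$, and $\boldsymbol A$ is a nice attention map with parameter $\psi$ that reflects $f:[c]\to2^{[c]}$, then $\boldsymbol A\mathcal V$ is a good sequence converging to $$\mathcal Z'=\Bigl(\frac{\sum_{y\in f(x)}\pi_y\boldsymbol z_y}{\sum_{y\in f(x)}\pi_y}\Bigr)_{x\in[c]}$$ (the entry being $\boldsymbol 0$ where $f(x)=\emptyset$) with parameter $$C\psi(\gamma+N)+C\,N\log n,\qquad N=\max_{y\in[c]}\|\boldsymbol z_y\|.$$ -/

import Mathlib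

open MeasureTheory

noncomputable section

/-- Transition probabilities of the simple random walk on `G`: from `x` the walk moves to a
uniformly chosen neighbour of `x`. -/
def walkProb {c : ℕ} (G : SimpleGraph (Fin c)) (x y : Fin c) : ℝ :=
  open Classical in if G.Adj x y then 1 / (G.degree x : ℝ) else 0

/-- `π` is a stationary distribution of the simple random walk on `G`
(it is unique when `G` is connected). -/
structure IsWalkStationary {c : ℕ} (G : SimpleGraph (Fin c)) (π : Fin c → ℝ) : Prop where
  nonneg : ∀ x, 0 ≤ π x
  sum_eq_one : ∑ x, π x = 1
  invariant : ∀ y, ∑ x, π x * walkProb G x y = π y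

/-- The data-generating process. Positions are indexed from `0`, so index `k` stands for the
`(k + 1)`-st token. The first `c` tokens traverse the vocabulary; the next one has law `π`; from
there on the tokens form a random walk on `G` (a Markov chain with kernel `walkProb G`). -/
structure IsTokenProcess {c n : ℕ} (G : SimpleGraph (Fin c)) (π : Fin c → ℝ)
    {Ω : Type*} [MeasurableSpace Ω] (μ : Measure Ω) (X : Fin n → Ω → Fin c) : Prop where
  measurable : ∀ k, Measurable (X k)
  traversal : ∀ (k : Fin n) (hk : (k : ℕ) < c), ∀ᵐ ω ∂μ, X k ω = ⟨k, hk⟩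
  initial : ∀ (h : c < n) (y : Fin c), μ.real {ω | X ⟨c, h⟩ ω = y} = π y
  step : ∀ (k : ℕ) (hk : k + 1 < n), c ≤ k → ∀ s : Fin n → Fin c,
    μ.real {ω | ∀ j : Fin n, (j : ℕ) ≤ k + 1 → X j ω = s j} =
      μ.real {ω | ∀ j : Fin n, (j : ℕ) ≤ k → X j ω = s j} *
        walkProb G (s ⟨k, (Nat.lt_succ_self k).trans hk⟩) (s ⟨k + 1, hk⟩)

/-- The number of occurrences of the token `y` among the tokens up to and including index `k`. -/
def tokenFreq {c n : ℕ} (x : Fin n → Fin c) (y : Fin c) (k : Fin n) : ℕ :=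
  ((Finset.Iic k).filter (fun j => x j = y)).card

/-- `U` is a good sequence (relative to the tokens `x`) converging to `Z` with parameter `γ`. -/
def IsGoodSequence {c n d : ℕ} (x : Fin n → Fin c) (U : Fin n → EuclideanSpace ℝ (Fin d))
    (Z : Fin c → EuclideanSpace ℝ (Fin d)) (γ : ℝ) : Prop :=
  0 < γ ∧ ∀ k : Fin n, ‖U k - Z (x k)‖ ≤ γ / √((k : ℝ) + 1)

/-- Attention maps: nonnegative, lower-triangular and row-stochastic matrices. -/
structure IsAttentionMap {n : ℕ} (A : Matrix (Fin n) (Fin n) ℝ) : Prop where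
  nonneg : ∀ k j, 0 ≤ A k j
  lower : ∀ k j, k < j → A k j = 0
  row_sum : ∀ k, ∑ j ∈ Finset.Iic k, A k j = 1

/-- Nice attention maps with parameter `ψ`. -/
structure IsNiceAttention {n : ℕ} (A : Matrix (Fin n) (Fin n) ℝ) (ψ : ℝ) : Prop
    extends IsAttentionMap A where
  pos : 0 < ψ
  nice : ∀ k j : Fin n, j ≤ k →
    ∑ i ∈ Finset.Iic j, A k i ≤ ψ * ((j : ℝ) + 1) / ((k : ℝ) + 1)

/-- `A` is a nice attention map with parameter `ψ` that reflects `f`. In `balanced`, the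
denominator can vanish only for an index `k < c`; then every `y ∈ f (x k)` is still unseen,
both terms are `0`, and the condition holds trivially. -/
structure ReflectsFunction {c n : ℕ} (x : Fin n → Fin c) (A : Matrix (Fin n) (Fin n) ℝ) (ψ : ℝ)
    (f : Fin c → Finset (Fin c)) : Prop extends IsNiceAttention A ψ where
  support : ∀ k j : Fin n, c ≤ (k : ℕ) → j ≤ k → 0 < A k j → x j ∈ f (x k)
  balanced : ∀ k : Fin n, ∀ y ∈ f (x k),
    |∑ j ∈ (Finset.Iic k).filter (fun j => x j = y), A k j -
        (tokenFreq x y k : ℝ) / ∑ y' ∈ f (x k), (tokenFreq x y' k : ℝ)| ≤ ψ / √((k : ℝ) + 1)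

/-- The sequence `A V`. -/
def attend {n d : ℕ} (A : Matrix (Fin n) (Fin n) ℝ) (V : Fin n → EuclideanSpace ℝ (Fin d)) :
    Fin n → EuclideanSpace ℝ (Fin d) :=
  fun k => ∑ j, A k j • V j

/-- The `π`-weighted averages of `Z` over the sets `f x` (equal to `0` where `f x` is empty). -/
def latentAverage {c d : ℕ} (π : Fin c → ℝ) (f : Fin c → Finset (Fin c))
    (Z : Fin c → EuclideanSpace ℝ (Fin d)) : Fin c → EuclideanSpace ℝ (Fin d) :=
  fun x => (∑ y ∈ f x, π y)⁻¹ • ∑ y ∈ f x, π y • Z y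

/-- The largest norm `N` of the latent representations (a maximum, as `Fin c` is finite). -/
def maxNorm {c d : ℕ} (Z : Fin c → EuclideanSpace ℝ (Fin d)) : ℝ := ⨆ y, ‖Z y‖

end

/-!
The simple random walk on a connected graph has a unique stationary distribution, proportional to
the degree (`IsWalkStationary.eq_degree_div`). Everything rests on the concentration of the token
frequencies around it, `F_{y,k} = π_y k + O(√k log n)` for all `y` and `k` at once
(`exists_tokenFreq_deviation_bound`). The walk may be periodic, so no mixing is used. Instead the
Poisson equation `h - P h = 1_y - π_y` is solved (`exists_poisson_solution`), which turns the
centred frequencies into a martingale with bounded increments, up to a bounded error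
(`abs_sum_sub_walkMartingale_le`). A Chernoff bound for this martingale
(`measureReal_walkMartingale_ge_le`) survives the union over `y` and `k` (with a total
below `0.001`) thanks to the factor `log n`.

On the resulting event the rest is deterministic. Let `a_{k,j}` be the attention weights.
* Replacing `v_j` by `z_{x_j}` costs `γ ∑_j a_{k,j} / √j`, and niceness bounds this by `2 ψ γ / √k`
  through summation by parts (`IsNiceAttention.norm_attend_sub_le`).
* After the traversal, `∑_j a_{k,j} z_{x_j}` is an average of the `z_y`, `y ∈ f (x_k)`, whose weights
  are within `ψ / √k` of the relative frequencies; these are within `O(log n / √k)` of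
  `π_y / ∑_{y' ∈ f (x_k)} π_{y'}` (`ReflectsFunction.norm_sum_smul_sub_latentAverage_le`).
* During the traversal `k ≤ c`, and the trivial bound `2 N` is of the right order because niceness
  forces `1 ≤ ψ`.
-/

/-! ### The random walk on a graph and its Poisson equation -/

/-- The averaging operator of the simple random walk: `walkStep G u x` is the mean of `u` after
one step from `x`. -/
noncomputable def walkStep {c : ℕ} (G : SimpleGraph (Fin c)) (u : Fin c → ℝ) (x : Fin c) : ℝ :=
  ∑ y, walkProb G x y * u y

lemma walkProb_nonneg {c : ℕ} (G : SimpleGraph (Fin c)) (x y : Fin c) : 0 ≤ walkProb G x y := by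
  unfold walkProb
  split_ifs <;> positivity

open Classical in
lemma degree_mul_walkProb {c : ℕ} (G : SimpleGraph (Fin c)) (x y : Fin c) :
    (G.degree x : ℝ) * walkProb G x y = if G.Adj x y then 1 else 0 := by
  unfold walkProb
  split_ifs with h
  · have : 0 < G.degree x := (G.degree_pos_iff_exists_adj x).2 ⟨y, h⟩
    field_simp
  · simp

open Classical in
lemma degree_mul_walkStep {c : ℕ} (G : SimpleGraph (Fin c)) (u : Fin c → ℝ) (x : Fin c) :
    (G.degree x : ℝ) * walkStep G u x = ∑ y ∈ G.neighborFinset x, u y := by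
  simp only [walkStep, Finset.mul_sum, ← mul_assoc, degree_mul_walkProb, ite_mul, one_mul,
    zero_mul, SimpleGraph.neighborFinset_eq_filter, Finset.sum_filter]

open Classical in
lemma sum_walkProb {c : ℕ} (G : SimpleGraph (Fin c)) (x : Fin c) (hx : 0 < G.degree x) :
    ∑ y, walkProb G x y = 1 := by
  have h := degree_mul_walkStep G (fun _ => 1) x
  simp only [walkStep, mul_one, Finset.sum_const, SimpleGraph.card_neighborFinset_eq_degree,
    nsmul_eq_mul] at h
  have hx' : (G.degree x : ℝ) ≠ 0 := by exact_mod_cast hx.ne'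
  exact mul_left_cancel₀ hx' (by rw [h, mul_one])

/-- Functions harmonic for the walk on a connected graph lie in the kernel of the Laplacian, hence
are constant. -/
lemma eq_of_degree_mul_eq {c : ℕ} (G : SimpleGraph (Fin c)) (hG : G.Connected) (u : Fin c → ℝ)
    (hu : open Classical in ∀ x, (G.degree x : ℝ) * u x = ∑ y ∈ G.neighborFinset x, u y)
    (x y : Fin c) : u x = u y := by
  classical
  refine (G.lapMatrix_mulVec_eq_zero_iff_forall_reachable (x := u)).1 ?_ x y (hG.preconnected x y)
  ext z
  rw [SimpleGraph.lapMatrix_mulVec_apply]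
  have := hu z
  simp only [Pi.zero_apply, sub_eq_zero]
  convert this

open Classical in
/-- The stationary distribution of the walk on a connected graph is proportional to the degree:
reversibility turns invariance of `π` into harmonicity of `π x / deg x`. -/
lemma IsWalkStationary.eq_degree_div {c : ℕ} {G : SimpleGraph (Fin c)} (hG : G.Connected)
    (hdeg : ∀ x, 0 < G.degree x) {π : Fin c → ℝ} (hπ : IsWalkStationary G π) (x : Fin c) :
    π x = (G.degree x : ℝ) / ∑ y, (G.degree y : ℝ) := by
  have hd : ∀ x, (G.degree x : ℝ) ≠ 0 := fun x => by exact_mod_cast (hdeg x).ne'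
  have hconst := eq_of_degree_mul_eq G hG (fun x => π x / G.degree x) (fun y => by
    rw [mul_div_cancel₀ _ (hd y), ← hπ.invariant y, SimpleGraph.neighborFinset_eq_filter,
      Finset.sum_filter]
    refine Finset.sum_congr rfl fun x _ => ?_
    have := degree_mul_walkProb G x y
    rw [G.adj_comm] at this
    split_ifs at this ⊢ with h
    · field_simp [hd x]
      linear_combination π x * this
    · rw [(mul_eq_zero.1 this).resolve_left (hd x), mul_zero])
  have hmul : ∀ y, π y = (π x / G.degree x) * G.degree y := fun y => by
    rw [← hconst y x, div_mul_cancel₀ _ (hd y)]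
  have hs := hπ.sum_eq_one
  rw [Finset.sum_congr rfl fun y _ => hmul y, ← Finset.mul_sum] at hs
  have h0 : (∑ y, (G.degree y : ℝ)) ≠ 0 := right_ne_zero_of_mul_eq_one hs
  rw [eq_div_iff h0]
  have := hd x
  field_simp at hs
  linarith

open Classical in
lemma sum_degree_mul_sub_walkStep {c : ℕ} (G : SimpleGraph (Fin c)) (u : Fin c → ℝ) :
    ∑ x, (G.degree x : ℝ) * (u x - walkStep G u x) = 0 := by
  simp only [mul_sub, Finset.sum_sub_distrib, degree_mul_walkStep,
    SimpleGraph.neighborFinset_eq_filter, Finset.sum_filter]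
  rw [Finset.sum_comm, sub_eq_zero]
  refine Finset.sum_congr rfl fun x _ => ?_
  rw [← G.card_neighborFinset_eq_degree, SimpleGraph.neighborFinset_eq_filter,
    ← Finset.sum_filter]
  simp [G.adj_comm]

open Classical in
/-- Solvability of the Poisson equation. The operator `h ↦ h - walkStep G h + (∑ deg • h) • 1` is
injective, since harmonic functions are constant, hence surjective; on a right-hand side that is
orthogonal to the degrees its extra term vanishes. -/
lemma exists_poisson_solution {c : ℕ} (G : SimpleGraph (Fin c)) (hG : G.Connected)
    (hdeg : ∀ x, 0 < G.degree x) (g : Fin c → ℝ) (hg : ∑ x, (G.degree x : ℝ) * g x = 0) :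
    ∃ h : Fin c → ℝ, ∀ x, h x - walkStep G h x = g x := by
  have := hG.nonempty
  have hD : 0 < ∑ x, (G.degree x : ℝ) :=
    Finset.sum_pos (fun x _ => by exact_mod_cast hdeg x) Finset.univ_nonempty
  let T : (Fin c → ℝ) →ₗ[ℝ] (Fin c → ℝ) :=
    { toFun := fun h x => h x - walkStep G h x + ∑ z, (G.degree z : ℝ) * h z
      map_add' := fun u v => by
        ext x
        simp only [walkStep, Pi.add_apply, mul_add, Finset.sum_add_distrib]
        ring
      map_smul' := fun r u => by
        ext x
        simp only [walkStep, Pi.smul_apply, smul_eq_mul, RingHom.id_apply, mul_left_comm _ r,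
          ← Finset.mul_sum]
        ring }
  have hT : ∀ h x, T h x = h x - walkStep G h x + ∑ z, (G.degree z : ℝ) * h z := fun _ _ => rfl
  have hzero : ∀ h : Fin c → ℝ, ∑ x, (G.degree x : ℝ) * T h x = 0 →
      ∑ z, (G.degree z : ℝ) * h z = 0 := fun h h0 => by
    simp only [hT, mul_add _ (_ - _), Finset.sum_add_distrib, sum_degree_mul_sub_walkStep,
      zero_add, ← Finset.sum_mul] at h0
    exact (mul_eq_zero.1 h0).resolve_left hD.ne'
  have hinj : Function.Injective T := by
    refine (injective_iff_map_eq_zero T).2 fun h h0 => ?_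
    have hs := hzero h (by simp [h0])
    have hconst := eq_of_degree_mul_eq G hG h (fun x => by
      have hx := hT h x
      rw [h0, hs, Pi.zero_apply, add_zero, eq_comm, sub_eq_zero] at hx
      rw [hx, degree_mul_walkStep])
    ext x
    rw [Finset.sum_congr rfl fun z _ => by rw [hconst z x], ← Finset.sum_mul] at hs
    exact (mul_eq_zero.1 hs).resolve_left hD.ne'
  obtain ⟨h, hh⟩ := (LinearMap.injective_iff_surjective.1 hinj) g
  refine ⟨h, fun x => ?_⟩
  have := hT h x
  rw [hzero h (by rw [hh]; exact hg), hh, add_zero] at this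
  exact this.symm

lemma abs_walkStep_le {c : ℕ} (G : SimpleGraph (Fin c)) (u : Fin c → ℝ) {H : ℝ}
    (hu : ∀ x, |u x| ≤ H) (x : Fin c) (hx : ∑ y, walkProb G x y = 1) : |walkStep G u x| ≤ H := by
  refine (Finset.abs_sum_le_sum_abs _ _).trans ?_
  calc ∑ y, |walkProb G x y * u y| ≤ ∑ y, walkProb G x y * H := by
        refine Finset.sum_le_sum fun y _ => ?_
        rw [abs_mul, abs_of_nonneg (walkProb_nonneg G x y)]
        exact mul_le_mul_of_nonneg_left (hu y) (walkProb_nonneg G x y)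
    _ = H := by rw [← Finset.sum_mul, hx, one_mul]

/-! ### Hoeffding's lemma -/

/-- Hoeffding's lemma for a finitely supported law: `exp (t * v)` lies below the chord of `exp`
over `[-t * a, t * a]`, whose mean is `cosh (t * a)`. -/
lemma sum_mul_exp_le {ι : Type*} [Fintype ι] (p v : ι → ℝ) (hp : ∀ i, 0 ≤ p i)
    (hp1 : ∑ i, p i = 1) (hmean : ∑ i, p i * v i = 0) {a : ℝ} (ha : 0 < a)
    (hv : ∀ i, |v i| ≤ a) (t : ℝ) :
    ∑ i, p i * Real.exp (t * v i) ≤ Real.exp (t ^ 2 * a ^ 2 / 2) := by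
  have hchord : ∀ i, Real.exp (t * v i) ≤ Real.cosh (t * a) + v i / a * Real.sinh (t * a) := by
    intro i
    obtain ⟨h1, h2⟩ := abs_le.1 (hv i)
    have hw1 : 0 ≤ (1 + v i / a) / 2 := by
      have : -1 ≤ v i / a := by rw [le_div_iff₀ ha]; linarith
      linarith
    have hw2 : 0 ≤ (1 - v i / a) / 2 := by
      have : v i / a ≤ 1 := by rw [div_le_iff₀ ha]; linarith
      linarith
    have h := convexOn_exp.2 (Set.mem_univ (t * a)) (Set.mem_univ (-(t * a))) hw1 hw2 (by ring)
    simp only [smul_eq_mul] at h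
    rw [Real.cosh_eq, Real.sinh_eq]
    calc Real.exp (t * v i)
        = Real.exp ((1 + v i / a) / 2 * (t * a) + (1 - v i / a) / 2 * -(t * a)) := by
          congr 1
          field_simp
          ring
      _ ≤ _ := h
      _ = _ := by ring
  calc ∑ i, p i * Real.exp (t * v i)
      ≤ ∑ i, p i * (Real.cosh (t * a) + v i / a * Real.sinh (t * a)) :=
        Finset.sum_le_sum fun i _ => mul_le_mul_of_nonneg_left (hchord i) (hp i)
    _ = (∑ i, p i) * Real.cosh (t * a) + (∑ i, p i * v i) * (Real.sinh (t * a) / a) := by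
        rw [Finset.sum_mul, Finset.sum_mul, ← Finset.sum_add_distrib]
        exact Finset.sum_congr rfl fun i _ => by ring
    _ = Real.cosh (t * a) := by rw [hp1, hmean]; ring
    _ ≤ Real.exp ((t * a) ^ 2 / 2) := Real.cosh_le_exp_half_sq _
    _ = _ := by rw [mul_pow]

/-! ### The martingale of the Poisson equation -/

lemma integral_comp_eq_sum {Ω T : Type*} [MeasurableSpace Ω] {μ : Measure Ω}
    [IsProbabilityMeasure μ] [Fintype T] [MeasurableSpace T] [MeasurableSingletonClass T]
    {Z : Ω → T} (hZ : Measurable Z) (F : T → ℝ) :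
    ∫ ω, F (Z ω) ∂μ = ∑ t, μ.real {ω | Z ω = t} * F t := by
  have : IsProbabilityMeasure (μ.map Z) := Measure.isProbabilityMeasure_map hZ.aemeasurable
  rw [← integral_map hZ.aemeasurable (f := F) (measurable_of_finite F).aestronglyMeasurable,
    integral_fintype Integrable.of_finite]
  refine Finset.sum_congr rfl fun t _ => ?_
  rw [map_measureReal_apply hZ (measurableSet_singleton t), smul_eq_mul]
  rfl

/-- One step of the Markov property, for functionals of the path up to time `k + 1`. -/
lemma integral_path_succ {c : ℕ} (G : SimpleGraph (Fin c)) {Ω : Type*} [MeasurableSpace Ω]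
    {μ : Measure Ω} [IsProbabilityMeasure μ] {Y : ℕ → Ω → Fin c} (hY : ∀ i, Measurable (Y i))
    (k : ℕ)
    (hstep : ∀ (t : Fin (k + 1) → Fin c) (y : Fin c),
      μ.real {ω | (∀ i : Fin (k + 1), Y i ω = t i) ∧ Y (k + 1) ω = y} =
        μ.real {ω | ∀ i : Fin (k + 1), Y i ω = t i} * walkProb G (t (Fin.last k)) y)
    (Φ : (Fin (k + 1) → Fin c) → Fin c → ℝ) :
    ∫ ω, Φ (fun i => Y i ω) (Y (k + 1) ω) ∂μ =
      ∫ ω, ∑ y, walkProb G (Y k ω) y * Φ (fun i => Y i ω) y ∂μ := by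
  have hpre : Measurable fun ω => (fun i : Fin (k + 1) => Y i ω) :=
    measurable_pi_lambda _ fun i => hY i
  have hL := integral_comp_eq_sum (μ := μ) (hpre.prodMk (hY (k + 1)))
    (fun p : (Fin (k + 1) → Fin c) × Fin c => Φ p.1 p.2)
  have hR := integral_comp_eq_sum (μ := μ) hpre
    (fun t => ∑ y, walkProb G (t (Fin.last k)) y * Φ t y)
  simp only [Fin.val_last] at hL hR
  rw [hL, hR, Fintype.sum_prod_type]
  refine Finset.sum_congr rfl fun t _ => ?_
  rw [Finset.mul_sum]
  refine Finset.sum_congr rfl fun y _ => ?_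
  have := hstep t y
  simp only [Prod.mk.injEq, funext_iff] at this ⊢
  rw [this, mul_assoc]

/-- The martingale attached to the solution `h` of a Poisson equation, along the token sequence
`s`. Its increments are frozen to `0` before time `c`, when the tokens do not yet form a walk. -/
noncomputable def walkMartingale {c : ℕ} (G : SimpleGraph (Fin c)) (h : Fin c → ℝ)
    (s : ℕ → Fin c) (k : ℕ) : ℝ :=
  ∑ i ∈ Finset.range k, if c ≤ i then h (s (i + 1)) - walkStep G h (s i) else 0

lemma walkMartingale_succ {c : ℕ} (G : SimpleGraph (Fin c)) (h : Fin c → ℝ) (s : ℕ → Fin c)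
    (k : ℕ) : walkMartingale G h s (k + 1) = walkMartingale G h s k +
      if c ≤ k then h (s (k + 1)) - walkStep G h (s k) else 0 :=
  Finset.sum_range_succ _ _

lemma walkMartingale_neg {c : ℕ} (G : SimpleGraph (Fin c)) (h : Fin c → ℝ) (s : ℕ → Fin c)
    (k : ℕ) : walkMartingale G (fun x => -h x) s k = -walkMartingale G h s k := by
  rw [walkMartingale, walkMartingale, ← Finset.sum_neg_distrib]
  refine Finset.sum_congr rfl fun i _ => ?_
  split_ifs
  · simp only [walkStep, mul_neg, Finset.sum_neg_distrib]
    ring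
  · simp

lemma measurable_walkMartingale {c : ℕ} (G : SimpleGraph (Fin c)) (h : Fin c → ℝ) {Ω : Type*}
    [MeasurableSpace Ω] {Y : ℕ → Ω → Fin c} (hY : ∀ i, Measurable (Y i)) (k : ℕ) :
    Measurable fun ω => walkMartingale G h (fun i => Y i ω) k := by
  refine Finset.measurable_sum _ fun i _ => ?_
  split_ifs
  · exact ((measurable_of_finite h).comp (hY (i + 1))).sub
      ((measurable_of_finite (walkStep G h)).comp (hY i))
  · exact measurable_const

lemma abs_walkMartingale_le {c : ℕ} (G : SimpleGraph (Fin c)) {h : Fin c → ℝ}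
    (hG : ∀ x, ∑ y, walkProb G x y = 1) {H : ℝ} (hh : ∀ x, |h x| ≤ H) (s : ℕ → Fin c) (k : ℕ) :
    |walkMartingale G h s k| ≤ k * (2 * H) := by
  refine (Finset.abs_sum_le_sum_abs _ _).trans ?_
  rw [← nsmul_eq_mul]
  conv_rhs => rw [← Finset.card_range k]
  refine Finset.sum_le_card_nsmul _ _ _ fun i _ => ?_
  have h1 := abs_le.1 (hh (s (i + 1)))
  have h2 := abs_le.1 (abs_walkStep_le G h hh (s i) (hG _))
  split_ifs
  · rw [abs_le]; constructor <;> linarith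
  · rw [abs_zero]; linarith

/-- Exponential moments of the martingale: each walk step costs a factor given by Hoeffding's
lemma. -/
lemma integral_exp_walkMartingale_le {c : ℕ} (G : SimpleGraph (Fin c)) {Ω : Type*}
    [MeasurableSpace Ω] {μ : Measure Ω} [IsProbabilityMeasure μ] {Y : ℕ → Ω → Fin c}
    (hY : ∀ i, Measurable (Y i)) (n : ℕ)
    (hstep : ∀ k, c ≤ k → k + 1 < n → ∀ (t : Fin (k + 1) → Fin c) (y : Fin c),
      μ.real {ω | (∀ i : Fin (k + 1), Y i ω = t i) ∧ Y (k + 1) ω = y} =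
        μ.real {ω | ∀ i : Fin (k + 1), Y i ω = t i} * walkProb G (t (Fin.last k)) y)
    (hG : ∀ x, ∑ y, walkProb G x y = 1) {h : Fin c → ℝ} {H : ℝ} (hH : 0 < H)
    (hh : ∀ x, |h x| ≤ H) (t : ℝ) (k : ℕ) (hk : k < n) :
    ∫ ω, Real.exp (t * walkMartingale G h (fun i => Y i ω) k) ∂μ ≤
      Real.exp (k * (t ^ 2 * (2 * H) ^ 2 / 2)) := by
  have hint : ∀ k, Integrable
      (fun ω => Real.exp (t * walkMartingale G h (fun i => Y i ω) k)) μ := fun k => by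
    refine Integrable.of_bound (C := Real.exp (|t| * (k * (2 * H))))
      ((measurable_walkMartingale G h hY k).const_mul t).exp.aestronglyMeasurable
      (Filter.Eventually.of_forall fun ω => ?_)
    rw [Real.norm_eq_abs, Real.abs_exp, Real.exp_le_exp]
    refine (le_abs_self _).trans ?_
    rw [abs_mul]
    exact mul_le_mul_of_nonneg_left (abs_walkMartingale_le G hG hh _ k) (abs_nonneg t)
  induction k with
  | zero => simp [walkMartingale]
  | succ k ih =>
    have ih := ih (by omega)
    have hexp : Real.exp ((k + 1 : ℕ) * (t ^ 2 * (2 * H) ^ 2 / 2)) =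
        Real.exp (k * (t ^ 2 * (2 * H) ^ 2 / 2)) * Real.exp (t ^ 2 * (2 * H) ^ 2 / 2) := by
      rw [← Real.exp_add]
      push_cast
      ring_nf
    rw [hexp]
    by_cases hck : c ≤ k
    · -- The value of the martingale at time `k`, as a function of the path up to time `k`.
      let W : (Fin (k + 1) → Fin c) → ℝ := fun s =>
        ∑ i : Fin k, if c ≤ (i : ℕ) then h (s i.succ) - walkStep G h (s i.castSucc) else 0
      have hW : ∀ ω, walkMartingale G h (fun i => Y i ω) k = W (fun i => Y i ω) := fun ω => by
        simp only [walkMartingale, Finset.sum_range, W, Fin.val_succ, Fin.val_castSucc]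
      have hM := integral_path_succ G hY k (hstep k hck hk) (fun s y =>
        Real.exp (t * (W s + (h y - walkStep G h (s (Fin.last k))))))
      simp only [Fin.val_last, ← hW] at hM
      simp only [walkMartingale_succ, if_pos hck]
      rw [hM]
      refine le_trans ?_ (mul_le_mul_of_nonneg_right ih (Real.exp_pos _).le)
      rw [← integral_mul_const]
      refine integral_mono_of_nonneg (Filter.Eventually.of_forall fun ω => ?_)
        ((hint k).mul_const _) (Filter.Eventually.of_forall fun ω => ?_)
      · exact Finset.sum_nonneg fun y _ => mul_nonneg (walkProb_nonneg G _ y) (Real.exp_pos _).le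
      · simp only [mul_add t, Real.exp_add, mul_left_comm _ (Real.exp (t * walkMartingale _ _ _ _)),
          ← Finset.mul_sum]
        refine mul_le_mul_of_nonneg_left ?_ (Real.exp_pos _).le
        refine sum_mul_exp_le _ _ (walkProb_nonneg G _) (hG _) ?_ (by linarith) (fun y => ?_) t
        · rw [Finset.sum_congr rfl fun y _ => mul_sub _ _ _, Finset.sum_sub_distrib,
            ← Finset.sum_mul, hG, one_mul]
          exact sub_self _
        · have h1 := abs_le.1 (hh y)
          have h2 := abs_le.1 (abs_walkStep_le G h hh (Y k ω) (hG _))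
          rw [abs_le]; constructor <;> linarith
    · simp only [walkMartingale_succ, if_neg hck, add_zero]
      refine ih.trans (le_mul_of_one_le_right (Real.exp_pos _).le (Real.one_le_exp ?_))
      positivity

/-- Chernoff bound for the martingale, with the parameter `1 / √(k + 1)`. -/
lemma measureReal_walkMartingale_ge_le {c : ℕ} (G : SimpleGraph (Fin c)) {Ω : Type*}
    [MeasurableSpace Ω] {μ : Measure Ω} [IsProbabilityMeasure μ] {Y : ℕ → Ω → Fin c}
    (hY : ∀ i, Measurable (Y i)) (n : ℕ)
    (hstep : ∀ k, c ≤ k → k + 1 < n → ∀ (t : Fin (k + 1) → Fin c) (y : Fin c),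
      μ.real {ω | (∀ i : Fin (k + 1), Y i ω = t i) ∧ Y (k + 1) ω = y} =
        μ.real {ω | ∀ i : Fin (k + 1), Y i ω = t i} * walkProb G (t (Fin.last k)) y)
    (hG : ∀ x, ∑ y, walkProb G x y = 1) {h : Fin c → ℝ} {H : ℝ} (hH : 0 < H)
    (hh : ∀ x, |h x| ≤ H) (k : ℕ) (hk : k < n) (a : ℝ) :
    μ.real {ω | a * √((k : ℝ) + 1) ≤ walkMartingale G h (fun i => Y i ω) k} ≤
      Real.exp (2 * H ^ 2 - a) := by
  have hk1 : 0 < √((k : ℝ) + 1) := Real.sqrt_pos.2 (by positivity)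
  have hb : ∀ ω, ‖Real.exp ((√((k : ℝ) + 1))⁻¹ * walkMartingale G h (fun i => Y i ω) k)‖ ≤
      Real.exp ((√((k : ℝ) + 1))⁻¹ * (k * (2 * H))) := fun ω => by
    rw [Real.norm_eq_abs, Real.abs_exp, Real.exp_le_exp]
    exact mul_le_mul_of_nonneg_left ((le_abs_self _).trans (abs_walkMartingale_le G hG hh _ k))
      (by positivity)
  have hint : Integrable
      (fun ω => Real.exp ((√((k : ℝ) + 1))⁻¹ * walkMartingale G h (fun i => Y i ω) k)) μ :=
    Integrable.of_bound
      ((measurable_walkMartingale G h hY k).const_mul _).exp.aestronglyMeasurable _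
      (Filter.Eventually.of_forall hb)
  refine (ProbabilityTheory.measure_ge_le_exp_mul_mgf _
    (t := (√((k : ℝ) + 1))⁻¹) (by positivity) hint).trans ?_
  have hE := integral_exp_walkMartingale_le G hY n hstep hG hH hh (√((k : ℝ) + 1))⁻¹ k hk
  rw [sub_eq_neg_add, Real.exp_add]
  have h1 : -(√((k : ℝ) + 1))⁻¹ * (a * √((k : ℝ) + 1)) = -a := by
    field_simp
  rw [h1]
  refine mul_le_mul_of_nonneg_left (hE.trans (Real.exp_le_exp.2 ?_)) (Real.exp_pos _).le
  rw [inv_pow, Real.sq_sqrt (by positivity)]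
  have h2 : (k : ℝ) * ((k : ℝ) + 1)⁻¹ ≤ 1 := by
    rw [← div_eq_mul_inv, div_le_one (by positivity)]
    linarith
  nlinarith [sq_nonneg H]

/-- Telescoping of the Poisson equation: the centred occupation sums of a sequence differ from
the martingale by a bounded amount. -/
lemma abs_sum_sub_walkMartingale_le {c : ℕ} (G : SimpleGraph (Fin c))
    (hG : ∀ x, ∑ y, walkProb G x y = 1) {h g : Fin c → ℝ} {H : ℝ} (hh : ∀ x, |h x| ≤ H)
    (hg : ∀ x, h x - walkStep G h x = g x) (s : ℕ → Fin c) (k : ℕ) :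
    |∑ i ∈ Finset.range (k + 1), g (s i) - walkMartingale G h s k| ≤ (2 * c + 4) * H := by
  have hs := fun x => abs_le.1 (abs_walkStep_le G h hh x (hG x))
  have hb := fun x => abs_le.1 (hh x)
  have hcorr : ∀ k, |∑ i ∈ Finset.range k,
      if c ≤ i then 0 else h (s (i + 1)) - walkStep G h (s i)| ≤ c * (2 * H) := fun k => by
    refine (Finset.abs_sum_le_sum_abs _ _).trans ?_
    calc _ = ∑ i ∈ Finset.range k, if i < c then |h (s (i + 1)) - walkStep G h (s i)| else 0 := by
          refine Finset.sum_congr rfl fun i _ => ?_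
          split_ifs <;> first | omega | simp
      _ = ∑ i ∈ (Finset.range k).filter (· < c), |h (s (i + 1)) - walkStep G h (s i)| := by
          rw [Finset.sum_filter]
      _ ≤ ∑ i ∈ Finset.range c, |h (s (i + 1)) - walkStep G h (s i)| := by
          refine Finset.sum_le_sum_of_subset_of_nonneg (fun i hi => ?_) fun _ _ _ => abs_nonneg _
          simpa using (Finset.mem_filter.1 hi).2
      _ ≤ (Finset.range c).card • (2 * H) := by
          refine Finset.sum_le_card_nsmul _ _ _ fun i _ => ?_
          have h1 := hb (s (i + 1))
          have h2 := hs (s i)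
          rw [abs_le]; constructor <;> linarith
      _ = c * (2 * H) := by rw [Finset.card_range, nsmul_eq_mul]
  have htel : ∑ i ∈ Finset.range (k + 1), g (s i) - walkMartingale G h s k =
      (∑ i ∈ Finset.range k, if c ≤ i then 0 else h (s (i + 1)) - walkStep G h (s i)) +
        (h (s 0) - h (s k)) + g (s k) := by
    have h1 := Finset.sum_range_sub' (fun i => h (s i)) k
    rw [← h1, Finset.sum_range_succ, walkMartingale, add_sub_right_comm, ← Finset.sum_sub_distrib,
      ← Finset.sum_add_distrib]
    congr 1
    refine Finset.sum_congr rfl fun i _ => ?_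
    rw [← hg]
    split_ifs <;> ring
  rw [htel, ← hg]
  have h0 := abs_le.1 (hcorr k)
  have h1 := hb (s 0)
  have h2 := hb (s k)
  have h3 := hs (s k)
  rw [abs_le]; constructor <;> nlinarith

/-! ### Concentration of the token frequencies -/

/-- Extension of a nonempty finite sequence to `ℕ` by repeating its last term. -/
def extendLast {n : ℕ} {α : Type*} (hn : 0 < n) (x : Fin n → α) (i : ℕ) : α :=
  x ⟨min i (n - 1), by omega⟩

lemma extendLast_of_lt {n : ℕ} {α : Type*} (hn : 0 < n) (x : Fin n → α) {i : ℕ} (hi : i < n) :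
    extendLast hn x i = x ⟨i, hi⟩ := by
  unfold extendLast
  congr 2
  omega

lemma sum_Iic_eq_sum_range {n : ℕ} {M : Type*} [AddCommMonoid M] (g : ℕ → M) (k : Fin n) :
    ∑ j ∈ Finset.Iic k, g j = ∑ i ∈ Finset.range (k + 1), g i := by
  refine Finset.sum_bij' (fun j _ => (j : ℕ))
    (fun i hi => ⟨i, by have := Finset.mem_range.1 hi; omega⟩) ?_ ?_ ?_ ?_ ?_
  · intro j hj
    have := Fin.le_def.1 (Finset.mem_Iic.1 hj)
    simp only [Finset.mem_range]
    omega
  · intro i hi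
    have := Finset.mem_range.1 hi
    simp only [Finset.mem_Iic, Fin.le_def]
    omega
  · intros; rfl
  · intros; rfl
  · intros; rfl

lemma tokenFreq_eq_sum {c n : ℕ} (hn : 0 < n) (x : Fin n → Fin c) (y : Fin c) (k : Fin n) :
    (tokenFreq x y k : ℝ) =
      ∑ i ∈ Finset.range (k + 1), if extendLast hn x i = y then (1 : ℝ) else 0 := by
  rw [← sum_Iic_eq_sum_range (fun i => if extendLast hn x i = y then (1 : ℝ) else 0), tokenFreq,
    Finset.card_filter]
  push_cast
  exact Finset.sum_congr rfl fun j _ => by rw [extendLast_of_lt hn x j.2]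

lemma IsTokenProcess.step_extendLast {c n : ℕ} {G : SimpleGraph (Fin c)} {π : Fin c → ℝ}
    {Ω : Type*} [MeasurableSpace Ω] {μ : Measure Ω} {X : Fin n → Ω → Fin c}
    (hX : IsTokenProcess G π μ X) (hn : 0 < n) (k : ℕ) (hck : c ≤ k) (hk : k + 1 < n)
    (t : Fin (k + 1) → Fin c) (y : Fin c) :
    μ.real {ω | (∀ i : Fin (k + 1), extendLast hn (fun j => X j ω) i = t i) ∧
        extendLast hn (fun j => X j ω) (k + 1) = y} =
      μ.real {ω | ∀ i : Fin (k + 1), extendLast hn (fun j => X j ω) i = t i} *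
        walkProb G (t (Fin.last k)) y := by
  have h := hX.step k hk hck
    (fun j => if hj : (j : ℕ) < k + 1 then t ⟨j, hj⟩ else y)
  have hpre : ∀ ω, (∀ j : Fin n, (j : ℕ) ≤ k →
      X j ω = if hj : (j : ℕ) < k + 1 then t ⟨j, hj⟩ else y) ↔
      ∀ i : Fin (k + 1), extendLast hn (fun j => X j ω) i = t i := fun ω => by
    constructor
    · intro H i
      rw [extendLast_of_lt hn _ (i.2.trans hk), H _ (Nat.lt_succ_iff.1 i.2), dif_pos i.2]
    · intro H j hj
      have := H ⟨j, Nat.lt_succ_of_le hj⟩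
      rw [extendLast_of_lt hn _ j.2] at this
      rw [dif_pos (Nat.lt_succ_of_le hj), ← this]
  have hsucc : ∀ ω, (∀ j : Fin n, (j : ℕ) ≤ k + 1 →
      X j ω = if hj : (j : ℕ) < k + 1 then t ⟨j, hj⟩ else y) ↔
      (∀ i : Fin (k + 1), extendLast hn (fun j => X j ω) i = t i) ∧
        extendLast hn (fun j => X j ω) (k + 1) = y := fun ω => by
    rw [← hpre, extendLast_of_lt hn _ hk]
    constructor
    · intro H
      refine ⟨fun j hj => H j (by omega), ?_⟩
      rw [H _ le_rfl, dif_neg (lt_irrefl _)]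
    · rintro ⟨H, H'⟩ j hj
      rcases Nat.lt_or_ge k j with hkj | hkj
      · have hj' : j = ⟨k + 1, hk⟩ := Fin.ext (by simp only; omega)
        rw [hj', H', dif_neg (lt_irrefl _)]
      · exact H j hkj
  simp only [hpre, hsucc] at h
  rw [h, dif_pos (Nat.lt_succ_self k), dif_neg (lt_irrefl _)]
  rfl

lemma two_mul_pow_le_of_ten_lt {c n : ℕ} (hcn : 10 * c < n) (hc : 1 ≤ c) :
    (n * c : ℕ) * (2 * Real.exp (-(6 * Real.log n))) ≤ 0.001 := by
  have hn : (11 : ℝ) ≤ n := by exact_mod_cast (by omega : 11 ≤ n)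
  have hc' : (c : ℝ) ≤ n := by exact_mod_cast (by omega : c ≤ n)
  have h6 : Real.exp (-(6 * Real.log n)) = ((n : ℝ) ^ 6)⁻¹ := by
    rw [Real.exp_neg, show 6 * Real.log n = Real.log ((n : ℝ) ^ 6) by simp [Real.log_pow],
      Real.exp_log (by positivity)]
  rw [h6, ← mul_assoc, ← div_eq_mul_inv, div_le_iff₀ (by positivity)]
  push_cast
  have h4 : (11 : ℝ) ^ 4 ≤ (n : ℝ) ^ 4 := by gcongr
  have h2 : (n : ℝ) * c ≤ n ^ 2 := by nlinarith
  have h3 : (n : ℝ) ^ 6 = n ^ 2 * n ^ 4 := by ring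
  rw [h3]
  nlinarith [mul_le_mul_of_nonneg_left h4 (sq_nonneg (n : ℝ))]

lemma one_le_log_of_three_le {n : ℕ} (hn : 3 ≤ n) : 1 ≤ Real.log n := by
  rw [Real.le_log_iff_exp_le (by positivity)]
  have h3 : (3 : ℝ) ≤ n := by exact_mod_cast hn
  linarith [Real.exp_one_lt_d9]

open Classical in
/-- Concentration of the token frequencies, simultaneously in time and token. -/
lemma exists_tokenFreq_deviation_bound {c : ℕ} (G : SimpleGraph (Fin c)) (hG : G.Connected)
    (hdeg : ∀ x, 0 < G.degree x) :
    ∃ D : ℝ, 0 < D ∧ ∀ (π : Fin c → ℝ), IsWalkStationary G π → ∀ (n : ℕ), 10 * c < n →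
      ∀ (Ω : Type*) [MeasurableSpace Ω] (μ : Measure Ω) [IsProbabilityMeasure μ]
        (X : Fin n → Ω → Fin c), IsTokenProcess G π μ X →
      ∃ E : Set Ω, MeasurableSet E ∧ 0.999 ≤ μ.real E ∧ ∀ ω ∈ E, ∀ (k : Fin n) (y : Fin c),
        |(tokenFreq (fun k => X k ω) y k : ℝ) - π y * ((k : ℝ) + 1)| ≤
          D * √((k : ℝ) + 1) * Real.log n := by
  have hne := hG.nonempty
  have hc : 1 ≤ c := by
    have := Fin.pos hne.some
    omega
  have hD : 0 < ∑ x, (G.degree x : ℝ) :=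
    Finset.sum_pos (fun x _ => by exact_mod_cast hdeg x) Finset.univ_nonempty
  have hP : ∀ x, ∑ y, walkProb G x y = 1 := fun x => sum_walkProb G x (hdeg x)
  choose h hh using fun y : Fin c => exists_poisson_solution G hG hdeg
    (fun x => (if x = y then 1 else 0) - (G.degree y : ℝ) / ∑ z, (G.degree z : ℝ)) (by
      simp only [mul_sub, Finset.sum_sub_distrib, ← Finset.sum_mul]
      rw [mul_div_cancel₀ _ hD.ne']
      simp)
  set H : ℝ := 1 + ∑ y, ∑ x, |h y x| with hHdef
  have hH : 0 < H := by positivity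
  have hhH : ∀ y x, |h y x| ≤ H := fun y x => by
    have h1 := Finset.single_le_sum (f := fun x => |h y x|) (fun _ _ => abs_nonneg _)
      (Finset.mem_univ x)
    have h2 := Finset.single_le_sum (f := fun y => ∑ x, |h y x|)
      (fun _ _ => Finset.sum_nonneg fun _ _ => abs_nonneg _) (Finset.mem_univ y)
    linarith
  -- `6 + 2 * H ^ 2` brings each of the `2 * c * n` tail probabilities below `n ^ (-6)`; the rest
  -- absorbs the bounded error of the martingale approximation.
  refine ⟨6 + 2 * H ^ 2 + (2 * c + 4) * H, by positivity, ?_⟩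
  intro π hπ n hcn Ω _ μ _ X hX
  have hn : 0 < n := by omega
  have hlog : 1 ≤ Real.log n := one_le_log_of_three_le (by omega)
  set Y : ℕ → Ω → Fin c := fun i ω => extendLast hn (fun j => X j ω) i with hYdef
  have hY : ∀ i, Measurable (Y i) := fun i => hX.measurable _
  have hstep : ∀ k, c ≤ k → k + 1 < n → ∀ (t : Fin (k + 1) → Fin c) (y : Fin c),
      μ.real {ω | (∀ i : Fin (k + 1), Y i ω = t i) ∧ Y (k + 1) ω = y} =
        μ.real {ω | ∀ i : Fin (k + 1), Y i ω = t i} * walkProb G (t (Fin.last k)) y :=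
    fun k hck hk t y => hX.step_extendLast hn k hck hk t y
  set a : ℝ := (6 + 2 * H ^ 2) * Real.log n with ha
  set E : Set Ω := {ω | ∀ (k : Fin n) (y : Fin c),
    |(tokenFreq (fun k => X k ω) y k : ℝ) - π y * ((k : ℝ) + 1)| ≤
      (6 + 2 * H ^ 2 + (2 * c + 4) * H) * √((k : ℝ) + 1) * Real.log n} with hE
  have hEmeas : MeasurableSet E := by
    have hpath : Measurable fun ω => (fun k => X k ω) := measurable_pi_lambda _ hX.measurable
    exact hpath (t := {x | ∀ (k : Fin n) (y : Fin c),
      |(tokenFreq x y k : ℝ) - π y * ((k : ℝ) + 1)| ≤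
        (6 + 2 * H ^ 2 + (2 * c + 4) * H) * √((k : ℝ) + 1) * Real.log n})
      (Set.toFinite _).measurableSet
  let B : Fin n × Fin c → Set Ω := fun q =>
    {ω | a * √(((q.1 : ℕ) : ℝ) + 1) ≤ walkMartingale G (h q.2) (fun i => Y i ω) q.1} ∪
    {ω | a * √(((q.1 : ℕ) : ℝ) + 1) ≤ walkMartingale G (fun x => -h q.2 x) (fun i => Y i ω) q.1}
  have hexp : Real.exp (2 * H ^ 2 - a) ≤ Real.exp (-(6 * Real.log n)) :=
    Real.exp_le_exp.2 (by rw [ha]; nlinarith [sq_nonneg H])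
  have hB : ∀ q, μ.real (B q) ≤ 2 * Real.exp (-(6 * Real.log n)) := fun q => by
    have h1 := measureReal_walkMartingale_ge_le (μ := μ) G hY n hstep hP hH (hhH q.2) q.1 q.1.2 a
    have h2 := measureReal_walkMartingale_ge_le (μ := μ) G hY n hstep hP hH
      (h := fun x => -h q.2 x) (fun x => by rw [abs_neg]; exact hhH q.2 x) q.1 q.1.2 a
    refine (measureReal_union_le _ _).trans ?_
    linarith
  have hsub : Eᶜ ⊆ ⋃ q, B q := by
    intro ω hω
    by_contra hnot
    refine hω fun k y => ?_
    simp only [B, Set.mem_iUnion, not_exists, Set.mem_union, Set.mem_ofPred_eq, not_or, not_le,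
      walkMartingale_neg] at hnot
    obtain ⟨h1, h2⟩ := hnot (k, y)
    simp only at h1 h2
    have hdev := abs_sum_sub_walkMartingale_le G hP (hhH y) (hh y) (fun i => Y i ω) k
    rw [Finset.sum_sub_distrib, ← hπ.eq_degree_div hG hdeg y, Finset.sum_const, Finset.card_range,
      nsmul_eq_mul] at hdev
    have hfreq := tokenFreq_eq_sum hn (fun j => X j ω) y k
    simp only [hYdef] at hdev h1 h2
    rw [← hfreq] at hdev
    push_cast at hdev
    have hsqrt : 1 ≤ √(((k : ℕ) : ℝ) + 1) :=
      Real.one_le_sqrt.2 (by linarith [(k : ℕ).cast_nonneg (α := ℝ)])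
    have hsl : 1 ≤ √(((k : ℕ) : ℝ) + 1) * Real.log n := one_le_mul_of_one_le_of_one_le hsqrt hlog
    have hcH : 0 ≤ (2 * c + 4) * H := by positivity
    have hrest := le_mul_of_one_le_right hcH hsl
    have hdev' := abs_le.1 hdev
    have hsplit : (6 + 2 * H ^ 2 + (2 * c + 4) * H) * √((k : ℝ) + 1) * Real.log n =
        a * √((k : ℝ) + 1) + (2 * c + 4) * H * (√((k : ℝ) + 1) * Real.log n) := by
      rw [ha]; ring
    rw [hsplit, abs_le]
    constructor <;> linarith
  have hbad : μ.real Eᶜ ≤ 0.001 := by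
    refine (measureReal_mono hsub).trans ((measureReal_iUnion_fintype_le _).trans ?_)
    refine (Finset.sum_le_card_nsmul _ _ _ fun q _ => hB q).trans ?_
    rw [nsmul_eq_mul, Finset.card_univ, Fintype.card_prod, Fintype.card_fin, Fintype.card_fin]
    exact two_mul_pow_le_of_ten_lt hcn hc
  refine ⟨E, hEmeas, ?_, fun ω hω => hω⟩
  have := probReal_compl_eq_one_sub (μ := μ) hEmeas
  rw [this] at hbad
  linarith

/-! ### Attention maps -/

/-- Summation by parts: weights whose partial sums over `range j` are at most `r * j` average
`1 / √(i + 1)` no worse, up to a constant, than uniform weights do. -/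
lemma sum_div_sqrt_le (a : ℕ → ℝ) {r : ℝ} (hr : 0 ≤ r) (m : ℕ)
    (ha : ∀ j ≤ m, ∑ i ∈ Finset.range j, a i ≤ r * j) :
    ∑ i ∈ Finset.range m, a i / √((i : ℝ) + 1) ≤
      (∑ i ∈ Finset.range m, a i) / √(m : ℝ) + r * √(m : ℝ) := by
  induction m with
  | zero => simp
  | succ m ih =>
    have ih := ih fun j hj => ha j (by omega)
    rw [Finset.sum_range_succ, Finset.sum_range_succ]
    have hS := ha m (by omega)
    push_cast
    rcases Nat.eq_zero_or_pos m with rfl | hm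
    · simpa using hr
    set S := ∑ i ∈ Finset.range m, a i
    set v := √((m : ℝ) + 1)
    set u := √(m : ℝ)
    have hv : 0 < v := Real.sqrt_pos.2 (by positivity)
    have hu : 0 < u := Real.sqrt_pos.2 (by positivity)
    have huv : u ≤ v := Real.sqrt_le_sqrt (by linarith)
    have hu2 : (m : ℝ) = u * u := (Real.mul_self_sqrt (by positivity)).symm
    have key : S / u - S / v ≤ r * (v - u) := by
      calc S / u - S / v = S * ((v - u) / (u * v)) := by field_simp
        _ ≤ r * (u * u) * ((v - u) / (u * v)) := by
            rw [← hu2]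
            exact mul_le_mul_of_nonneg_right hS (div_nonneg (by linarith) (by positivity))
        _ = r * (v - u) * (u / v) := by field_simp
        _ ≤ r * (v - u) := by
            refine mul_le_of_le_one_right (mul_nonneg hr (by linarith)) ?_
            rwa [div_le_one hv]
    have : (S + a m) / v = S / v + a m / v := add_div _ _ _
    linarith

lemma IsNiceAttention.one_le {n : ℕ} {A : Matrix (Fin n) (Fin n) ℝ} {ψ : ℝ}
    (hA : IsNiceAttention A ψ) (k : Fin n) : 1 ≤ ψ := by
  have h := hA.nice k k le_rfl
  rwa [hA.row_sum, mul_div_cancel_right₀ _ (by positivity)] at h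

lemma IsNiceAttention.sum_div_sqrt_le {n : ℕ} {A : Matrix (Fin n) (Fin n) ℝ} {ψ : ℝ}
    (hA : IsNiceAttention A ψ) (k : Fin n) :
    ∑ j ∈ Finset.Iic k, A k j / √((j : ℝ) + 1) ≤ 2 * ψ / √((k : ℝ) + 1) := by
  have hn : 0 < n := k.pos
  let a : ℕ → ℝ := extendLast hn fun j => A k j
  have ha : ∀ j : Fin n, a j = A k j := fun j => extendLast_of_lt hn _ j.2
  have hk : (0 : ℝ) < (k : ℝ) + 1 := by positivity
  have hpartial : ∀ j ≤ (k : ℕ) + 1, ∑ i ∈ Finset.range j, a i ≤ ψ / ((k : ℝ) + 1) * j := by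
    intro j hj
    rcases j with _ | j
    · simp
    · have hjn : j < n := by omega
      have h := hA.nice k ⟨j, hjn⟩ (Fin.le_def.2 (by simp only; omega))
      rw [← sum_Iic_eq_sum_range a ⟨j, hjn⟩]
      simp only [ha]
      refine h.trans_eq ?_
      push_cast
      ring
  have h := _root_.sum_div_sqrt_le a (div_nonneg hA.pos.le hk.le) (k + 1) hpartial
  rw [← sum_Iic_eq_sum_range (fun i => a i / √((i : ℝ) + 1)), ← sum_Iic_eq_sum_range] at h
  simp only [ha, hA.row_sum] at h
  push_cast at h
  refine h.trans ?_
  have h1 := hA.one_le k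
  have hs : 0 < √((k : ℝ) + 1) := Real.sqrt_pos.2 hk
  rw [div_mul_eq_mul_div, mul_div_assoc, Real.sqrt_div_self', ← mul_div_assoc, mul_one, ← add_div]
  gcongr
  linarith

lemma IsAttentionMap.attend_eq {n d : ℕ} {A : Matrix (Fin n) (Fin n) ℝ} (hA : IsAttentionMap A)
    (V : Fin n → EuclideanSpace ℝ (Fin d)) (k : Fin n) :
    attend A V k = ∑ j ∈ Finset.Iic k, A k j • V j := by
  refine (Finset.sum_subset (Finset.subset_univ _) fun j _ hj => ?_).symm
  rw [hA.lower k j (not_le.1 fun h => hj (Finset.mem_Iic.2 h)), zero_smul]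

/-- Replacing the values by their limits costs a constant times `γ * ψ / √k`: niceness keeps the
attention away from early tokens. -/
lemma IsNiceAttention.norm_attend_sub_le {c n d : ℕ} {x : Fin n → Fin c}
    {V : Fin n → EuclideanSpace ℝ (Fin d)} {Z : Fin c → EuclideanSpace ℝ (Fin d)} {γ ψ : ℝ}
    {A : Matrix (Fin n) (Fin n) ℝ} (hV : IsGoodSequence x V Z γ) (hA : IsNiceAttention A ψ)
    (k : Fin n) :
    ‖attend A V k - ∑ j ∈ Finset.Iic k, A k j • Z (x j)‖ ≤ 2 * ψ * γ / √((k : ℝ) + 1) := by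
  rw [hA.attend_eq, ← Finset.sum_sub_distrib]
  calc ‖∑ j ∈ Finset.Iic k, (A k j • V j - A k j • Z (x j))‖
      ≤ ∑ j ∈ Finset.Iic k, γ * (A k j / √((j : ℝ) + 1)) := by
        refine norm_sum_le_of_le _ fun j _ => ?_
        rw [← smul_sub, norm_smul, Real.norm_of_nonneg (hA.nonneg k j)]
        refine (mul_le_mul_of_nonneg_left (hV.2 j) (hA.nonneg k j)).trans_eq ?_
        ring
    _ ≤ γ * (2 * ψ / √((k : ℝ) + 1)) := by
        rw [← Finset.mul_sum]
        exact mul_le_mul_of_nonneg_left (hA.sum_div_sqrt_le k) hV.1.le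
    _ = _ := by ring

lemma norm_le_maxNorm {c d : ℕ} (Z : Fin c → EuclideanSpace ℝ (Fin d)) (y : Fin c) :
    ‖Z y‖ ≤ maxNorm Z :=
  le_ciSup (f := fun y => ‖Z y‖) (Set.finite_range _).bddAbove y

lemma norm_latentAverage_le {c d : ℕ} {π : Fin c → ℝ} (hπ : ∀ x, 0 ≤ π x)
    (f : Fin c → Finset (Fin c)) (Z : Fin c → EuclideanSpace ℝ (Fin d)) (x : Fin c) :
    ‖latentAverage π f Z x‖ ≤ maxNorm Z := by
  have hs : 0 ≤ ∑ y ∈ f x, π y := Finset.sum_nonneg fun y _ => hπ y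
  have hN : 0 ≤ maxNorm Z := (norm_nonneg _).trans (norm_le_maxNorm Z x)
  rw [latentAverage, norm_smul, norm_inv, Real.norm_of_nonneg hs]
  calc (∑ y ∈ f x, π y)⁻¹ * ‖∑ y ∈ f x, π y • Z y‖
      ≤ (∑ y ∈ f x, π y)⁻¹ * ∑ y ∈ f x, π y * maxNorm Z := by
        refine mul_le_mul_of_nonneg_left (norm_sum_le_of_le _ fun y _ => ?_) (inv_nonneg.2 hs)
        rw [norm_smul, Real.norm_of_nonneg (hπ y)]
        exact mul_le_mul_of_nonneg_left (norm_le_maxNorm Z y) (hπ y)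
    _ = ((∑ y ∈ f x, π y)⁻¹ * ∑ y ∈ f x, π y) * maxNorm Z := by rw [← Finset.sum_mul, mul_assoc]
    _ ≤ maxNorm Z := mul_le_of_le_one_left hN inv_mul_le_one

lemma IsAttentionMap.norm_sum_smul_le {c n d : ℕ} {A : Matrix (Fin n) (Fin n) ℝ}
    (hA : IsAttentionMap A) (x : Fin n → Fin c) (Z : Fin c → EuclideanSpace ℝ (Fin d))
    (k : Fin n) : ‖∑ j ∈ Finset.Iic k, A k j • Z (x j)‖ ≤ maxNorm Z := by
  calc _ ≤ ∑ j ∈ Finset.Iic k, A k j * maxNorm Z := by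
        refine norm_sum_le_of_le _ fun j _ => ?_
        rw [norm_smul, Real.norm_of_nonneg (hA.nonneg k j)]
        exact mul_le_mul_of_nonneg_left (norm_le_maxNorm Z _) (hA.nonneg k j)
    _ = maxNorm Z := by rw [← Finset.sum_mul, hA.row_sum, one_mul]

/-- Relative frequencies inside a set `s` are close to conditional probabilities when the absolute
frequencies are. No lower bound on the total frequency of `s` is needed: the error splits as
`F y / F s * (1 - F s / (K * p s)) + (F y / K - p y) / p s`, and `F y / F s ≤ 1`. -/
lemma abs_div_sum_sub_div_sum_le {c : ℕ} {F p : Fin c → ℝ} {s : Finset (Fin c)} {K q δ : ℝ}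
    (hF : ∀ y, 0 ≤ F y) (hK : 0 < K) (hq : 0 < q) (hFs : 0 < ∑ y ∈ s, F y)
    (hps : q ≤ ∑ y ∈ s, p y) (hδ : ∀ y, |F y - p y * K| ≤ δ) {y : Fin c} (hy : y ∈ s) :
    |F y / ∑ y' ∈ s, F y' - p y / ∑ y' ∈ s, p y'| ≤ (c + 1) * δ / (K * q) := by
  have hsum : |∑ y' ∈ s, F y' - (∑ y' ∈ s, p y') * K| ≤ c * δ := by
    have hδ0 : 0 ≤ δ := (abs_nonneg _).trans (hδ y)
    rw [Finset.sum_mul, ← Finset.sum_sub_distrib]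
    refine (Finset.abs_sum_le_sum_abs _ _).trans ?_
    refine (Finset.sum_le_card_nsmul _ _ _ fun y _ => hδ y).trans ?_
    rw [nsmul_eq_mul]
    refine mul_le_mul_of_nonneg_right ?_ hδ0
    exact_mod_cast (Finset.card_le_univ s).trans_eq (Fintype.card_fin c)
  have hratio : F y / ∑ y' ∈ s, F y' ≤ 1 :=
    (div_le_one hFs).2 (Finset.single_le_sum (fun i _ => hF i) hy)
  have hratio0 : 0 ≤ F y / ∑ y' ∈ s, F y' := div_nonneg (hF y) hFs.le
  set Fs := ∑ y' ∈ s, F y'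
  set ps := ∑ y' ∈ s, p y'
  have hps0 : 0 < ps := hq.trans_le hps
  have hid : F y / Fs - p y / ps =
      ((F y - p y * K) - F y / Fs * (Fs - ps * K)) / (K * ps) := by
    field_simp
    ring
  rw [hid, abs_div, abs_of_pos (mul_pos hK hps0)]
  have hnum : |(F y - p y * K) - F y / Fs * (Fs - ps * K)| ≤ (c + 1) * δ := by
    refine (abs_sub _ _).trans ?_
    rw [abs_mul, abs_of_nonneg hratio0]
    have := mul_le_of_le_one_left (abs_nonneg (Fs - ps * K)) hratio
    linarith [hδ y]
  have h0 : 0 ≤ (c + 1) * δ := (abs_nonneg _).trans hnum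
  gcongr

lemma ReflectsFunction.sum_smul_eq {c n d : ℕ} {x : Fin n → Fin c}
    {A : Matrix (Fin n) (Fin n) ℝ} {ψ : ℝ} {f : Fin c → Finset (Fin c)}
    (hA : ReflectsFunction x A ψ f) (Z : Fin c → EuclideanSpace ℝ (Fin d)) {k : Fin n}
    (hk : c ≤ (k : ℕ)) :
    ∑ j ∈ Finset.Iic k, A k j • Z (x j) =
      ∑ y ∈ f (x k), (∑ j ∈ (Finset.Iic k).filter (fun j => x j = y), A k j) • Z y := by
  simp only [Finset.sum_smul, Finset.sum_filter]
  rw [Finset.sum_comm]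
  refine Finset.sum_congr rfl fun j hj => ?_
  have : ∀ y, (if x j = y then A k j else 0) • Z y = if x j = y then A k j • Z (x j) else 0 :=
    fun y => by split_ifs with h <;> simp [h]
  rw [Finset.sum_congr rfl fun y _ => this y, Finset.sum_ite_eq]
  split_ifs with h
  · rfl
  · have h0 : A k j = 0 := le_antisymm
      (not_lt.1 fun hpos => h (hA.support k j hk (Finset.mem_Iic.1 hj) hpos)) (hA.nonneg k j)
    rw [h0, zero_smul]

/-- A row of an attention map charges some token, which then has been seen. -/
lemma ReflectsFunction.exists_mem_tokenFreq_pos {c n : ℕ} {x : Fin n → Fin c}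
    {A : Matrix (Fin n) (Fin n) ℝ} {ψ : ℝ} {f : Fin c → Finset (Fin c)}
    (hA : ReflectsFunction x A ψ f) {k : Fin n} (hk : c ≤ (k : ℕ)) :
    ∃ y ∈ f (x k), 0 < tokenFreq x y k := by
  obtain ⟨j, hj, hpos⟩ : ∃ j ∈ Finset.Iic k, 0 < A k j := by
    by_contra! hnot
    have := Finset.sum_nonpos hnot
    rw [hA.row_sum] at this
    linarith
  exact ⟨x j, hA.support k j hk (Finset.mem_Iic.1 hj) hpos,
    Finset.card_pos.2 ⟨j, Finset.mem_filter.2 ⟨hj, rfl⟩⟩⟩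

/-- Beyond the traversal, averaging the limits `Z` along the tokens is close to averaging them
with respect to `π`. -/
lemma ReflectsFunction.norm_sum_smul_sub_latentAverage_le {c n d : ℕ} {x : Fin n → Fin c}
    {A : Matrix (Fin n) (Fin n) ℝ} {ψ : ℝ} {f : Fin c → Finset (Fin c)}
    (hA : ReflectsFunction x A ψ f) (Z : Fin c → EuclideanSpace ℝ (Fin d)) {k : Fin n}
    (hk : c ≤ (k : ℕ)) {π : Fin c → ℝ} {q : ℝ} (hq : 0 < q) (hπ : ∀ y, q ≤ π y) {B : ℝ}
    (hB : ∀ y, |(tokenFreq x y k : ℝ) - π y * ((k : ℝ) + 1)| ≤ B * √((k : ℝ) + 1)) :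
    ‖∑ j ∈ Finset.Iic k, A k j • Z (x j) - latentAverage π f Z (x k)‖ ≤
      c * ((ψ + (c + 1) * B / q) * maxNorm Z) / √((k : ℝ) + 1) := by
  obtain ⟨y₀, hy₀, hfreq⟩ := hA.exists_mem_tokenFreq_pos hk
  have hK : (0 : ℝ) < (k : ℝ) + 1 := by positivity
  have hs : 0 < √((k : ℝ) + 1) := Real.sqrt_pos.2 hK
  have hN : 0 ≤ maxNorm Z := (norm_nonneg _).trans (norm_le_maxNorm Z y₀)
  have hFs : 0 < ∑ y ∈ f (x k), (tokenFreq x y k : ℝ) :=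
    Finset.sum_pos' (fun y _ => Nat.cast_nonneg _) ⟨y₀, hy₀, by exact_mod_cast hfreq⟩
  have hps : q ≤ ∑ y ∈ f (x k), π y :=
    (hπ y₀).trans (Finset.single_le_sum (fun y _ => hq.le.trans (hπ y)) hy₀)
  rw [hA.sum_smul_eq Z hk, latentAverage, Finset.smul_sum, ← Finset.sum_sub_distrib]
  set w := (ψ + (c + 1) * B / q) / √((k : ℝ) + 1) with hw
  have hterm : ∀ y ∈ f (x k),
      ‖(∑ j ∈ (Finset.Iic k).filter (fun j => x j = y), A k j) • Z y -
        (∑ y ∈ f (x k), π y)⁻¹ • π y • Z y‖ ≤ w * maxNorm Z := by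
    intro y hy
    have h1 := hA.balanced k y hy
    have h2 := abs_div_sum_sub_div_sum_le (fun y => Nat.cast_nonneg (tokenFreq x y k)) hK hq hFs
      hps hB hy
    have h3 : (c + 1) * (B * √((k : ℝ) + 1)) / (((k : ℝ) + 1) * q) =
        (c + 1) * B / q / √((k : ℝ) + 1) := by
      conv_lhs => rw [← Real.mul_self_sqrt hK.le]
      rw [Real.sqrt_mul_self hs.le]
      field_simp
    rw [h3] at h2
    rw [smul_smul, ← sub_smul, norm_smul, Real.norm_eq_abs, inv_mul_eq_div]
    refine mul_le_mul ?_ (norm_le_maxNorm Z y) (norm_nonneg _) ?_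
    · refine (abs_sub_le _ _ _).trans ((add_le_add h1 h2).trans_eq ?_)
      rw [hw, add_div]
    · rw [hw, add_div]
      exact add_nonneg ((abs_nonneg _).trans h1) ((abs_nonneg _).trans h2)
  have hw0 : 0 ≤ w * maxNorm Z := (norm_nonneg _).trans (hterm y₀ hy₀)
  refine (norm_sum_le_of_le _ hterm).trans ?_
  rw [Finset.sum_const, nsmul_eq_mul]
  have hcard : ((f (x k)).card : ℝ) ≤ c := by
    exact_mod_cast (Finset.card_le_univ _).trans_eq (Fintype.card_fin c)
  refine (mul_le_mul_of_nonneg_right hcard hw0).trans_eq ?_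
  rw [hw]
  ring

theorem mainTheorem1 {c : ℕ} (G : SimpleGraph (Fin c)) (hG : G.Connected) :
    ∃ C : ℝ, 0 < C ∧
      ∀ (π : Fin c → ℝ), IsWalkStationary G π →
      ∀ (n : ℕ), 10 * c < n →
      ∀ (Ω : Type*) [MeasurableSpace Ω] (μ : Measure Ω) [IsProbabilityMeasure μ]
        (X : Fin n → Ω → Fin c), IsTokenProcess G π μ X →
      ∃ E : Set Ω, MeasurableSet E ∧ 0.999 ≤ μ.real E ∧
        ∀ ω ∈ E, ∀ (d : ℕ) (V : Fin n → EuclideanSpace ℝ (Fin d))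
          (Z : Fin c → EuclideanSpace ℝ (Fin d)) (γ : ℝ)
          (A : Matrix (Fin n) (Fin n) ℝ) (ψ : ℝ) (f : Fin c → Finset (Fin c)),
          IsGoodSequence (fun k => X k ω) V Z γ →
          ReflectsFunction (fun k => X k ω) A ψ f →
          IsGoodSequence (fun k => X k ω) (attend A V) (latentAverage π f Z)
            (C * ψ * (γ + maxNorm Z) + C * maxNorm Z * Real.log n) := by
  classical
  by_cases hdeg : ∀ x, 0 < G.degree x
  swap
  · -- A connected graph with an isolated vertex is a single vertex, which carries no stationary
    -- distribution since `walkProb` vanishes there.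
    refine ⟨1, one_pos, fun π hπ => ?_⟩
    exfalso
    rcases subsingleton_or_nontrivial (Fin c) with hsub | hnt
    · have h0 : ∀ y, π y = 0 := fun y => by
        rw [← hπ.invariant y]
        refine Finset.sum_eq_zero fun x _ => ?_
        rw [Subsingleton.elim x y, walkProb, if_neg (G.loopless.irrefl y), mul_zero]
      have := hπ.sum_eq_one
      simp [h0] at this
    · exact hdeg fun x => hG.preconnected.degree_pos_of_nontrivial x
  have hne := hG.nonempty
  have hc : (1 : ℝ) ≤ c := by exact_mod_cast Fin.pos hne.some
  have hS : 0 < ∑ x, (G.degree x : ℝ) :=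
    Finset.sum_pos (fun x _ => by exact_mod_cast hdeg x) Finset.univ_nonempty
  obtain ⟨D, hD, hconc⟩ := exists_tokenFreq_deviation_bound G hG (fun x => by convert hdeg x)
  set q : ℝ := 1 / ∑ x, (G.degree x : ℝ) with hqdef
  have hq : 0 < q := one_div_pos.2 hS
  have hR : 0 < c * ((c + 1) * D / q) := by positivity
  -- `2` comes from summation by parts, `2 * c` from the balance condition and from the traversal,
  -- and the last term from the concentration bound.
  refine ⟨2 * c + 2 + c * ((c + 1) * D / q), by positivity, ?_⟩
  intro π hπ n hcn Ω _ μ _ X hX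
  obtain ⟨E, hE, hprob, hdev⟩ := hconc π hπ n hcn Ω μ X hX
  refine ⟨E, hE, hprob, fun ω hω d V Z γ A ψ f hV hA => ?_⟩
  have hπq : ∀ y, q ≤ π y := fun y => by
    rw [hπ.eq_degree_div hG (fun x => by convert hdeg x) y]
    have h1 : (1 : ℝ) ≤ G.degree y := by exact_mod_cast hdeg y
    rw [hqdef]
    convert div_le_div_of_nonneg_right h1 hS.le
  have hN : 0 ≤ maxNorm Z := (norm_nonneg _).trans (norm_le_maxNorm Z hne.some)
  have hlog : 0 ≤ Real.log n := Real.log_natCast_nonneg n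
  have hγ := hV.1
  have hψ := hA.pos
  refine ⟨by positivity, fun k => ?_⟩
  have hK : (0 : ℝ) < (k : ℝ) + 1 := by positivity
  have hs : 0 < √((k : ℝ) + 1) := Real.sqrt_pos.2 hK
  have h1 := hA.norm_attend_sub_le hV k
  refine (norm_sub_le_norm_sub_add_norm_sub _
    (∑ j ∈ Finset.Iic k, A k j • Z (X j ω)) _).trans ?_
  have hψN : 0 ≤ ψ * maxNorm Z := by positivity
  have hψγ : 0 ≤ ψ * γ := by positivity
  have hNL : 0 ≤ maxNorm Z * Real.log n := by positivity
  rcases le_or_gt c (k : ℕ) with hk | hk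
  · have h2 := hA.norm_sum_smul_sub_latentAverage_le Z hk hq hπq (B := D * Real.log n)
      (fun y => (hdev ω hω k y).trans_eq (by ring))
    refine (add_le_add h1 h2).trans ?_
    rw [← add_div]
    refine div_le_div_of_nonneg_right ?_ hs.le
    have hexpand : (c : ℝ) * ((ψ + (c + 1) * (D * Real.log n) / q) * maxNorm Z) =
        c * (ψ * maxNorm Z) + c * ((c + 1) * D / q) * (maxNorm Z * Real.log n) := by ring
    rw [hexpand]
    nlinarith [mul_nonneg hR.le hψN, mul_nonneg hR.le hψγ, mul_nonneg (zero_le_one.trans hc) hψN,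
      mul_nonneg (zero_le_one.trans hc) hψγ, mul_nonneg (zero_le_one.trans hc) hNL]
  · -- During the traversal the trivial bound `2 * N` suffices, since `√(k + 1) ≤ c` and `1 ≤ ψ`.
    have h2 : ‖∑ j ∈ Finset.Iic k, A k j • Z (X j ω) - latentAverage π f Z (X k ω)‖ ≤
        2 * c * (ψ * maxNorm Z) / √((k : ℝ) + 1) := by
      refine (norm_sub_le _ _).trans ((add_le_add (hA.norm_sum_smul_le (fun k => X k ω) Z k)
        (norm_latentAverage_le hπ.nonneg f Z _)).trans ?_)
      rw [le_div_iff₀ hs]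
      have hsc : √((k : ℝ) + 1) ≤ c := by
        rw [Real.sqrt_le_left (by linarith)]
        have : (k : ℝ) + 1 ≤ c := by exact_mod_cast hk
        nlinarith
      have hNψ := le_mul_of_one_le_left hN (hA.one_le k)
      nlinarith [mul_le_mul hNψ hsc hs.le hψN]
    refine (add_le_add h1 h2).trans ?_
    rw [← add_div]
    refine div_le_div_of_nonneg_right ?_ hs.le
    nlinarith [mul_nonneg hR.le hψN, mul_nonneg hR.le hψγ, mul_nonneg (zero_le_one.trans hc) hψN,
      mul_nonneg (zero_le_one.trans hc) hψγ, mul_nonneg (zero_le_one.trans hc) hNL,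
      mul_nonneg hR.le hNL]
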